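/- Let $\mathcal V_L$ be the variety of all algebras (nonempty sets with operations) in the language $\{+,*,0,1\}$, where $+,*$ are binary and $0,1$ are constants, that satisfy the identities $$x+0\approx x,\qquad x+1\approx x*1,\qquad x*0\approx 0 .$$ An algebra is directly indecomposable if it has more than one element and, whenever it is isomorphic to a direct product $B\times C$, one of $B$, $C$ has exactly one element. Then: (1) The class of directly indecomposable members of $\mathcal V_L$ is not axiomatizable by a set of first-order sentences, i.e. there is no set $T$ of first-order sentences in the language $\{+,*,0,1\}$ whose models are exactly the directly indecomposable members of $\mathcal V_L$. (2) $\mathcal V_L$ is a variety with $\vec 0\,\&\,\vec 1$, witnessed by the constants $0$ and $1$: every $A\in\mathcal V_L$ with $0^A=1^A$ has only one element. (3) $\mathcal V_L$ does not have Definable Factor Congruences. That is, let $l\ge 0$ and let $\vec 0=(0_1,\dots,0_l)$, $\vec 1=(1_1,\dots,1_l)$ be any tuples of closed terms such that every $A\in\mathcal V_L$ with $\vec 0^A=\vec 1^A$ has only one element (for instance $l=1$ and the constants $0$, $1$). Then there is no first-order formula $\Phi(x,y,\vec z)$ in the language $\{+,*,0,1\}$, with $\vec z=(z_1,\dots,z_l)$,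 such that for all $A,B\in\mathcal V_L$, all $a,c\in A$ and all $b,d\in B$, $$A\times B\models\Phi\bigl(\langle a,b\rangle,\langle c,d\rangle,[\vec 0,\vec 1]\bigr)\quad\text{if and only if}\quad a=c,$$ where $[\vec 0,\vec 1]=\bigl((0_1^A,1_1^B),\dots,(0_l^A,1_l^B)\bigr)$. -/

import Mathlib

open scoped FirstOrder

universe u

namespace UAlg

open FirstOrder.Language

/-- The direct product of two structures, with coordinatewise operations. -/
instance prodStructure (L : FirstOrder.Language.{0, 0}) (A B : Type u)
    [L.Structure A] [L.Structure B] : L.Structure (A × B) where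
  funMap f x := (Structure.funMap f (fun i => (x i).1), Structure.funMap f (fun i => (x i).2))
  RelMap r x := Structure.RelMap r (fun i => (x i).1) ∧ Structure.RelMap r (fun i => (x i).2)

/-- A system of identities `s ≈ t` between terms in the variables `ℕ`. -/
abbrev Identities (L : FirstOrder.Language.{0, 0}) : Type := Set (L.Term ℕ × L.Term ℕ)

/-- `A` is an algebra (a nonempty structure) in the variety defined by the identities `E`. -/
def InVariety {L : FirstOrder.Language.{0, 0}} (E : Identities L) (A : Type u) [L.Structure A] : Prop :=
  Nonempty A ∧ ∀ e ∈ E, ∀ v : ℕ → A, e.1.realize v = e.2.realize v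

/-- `A` is directly indecomposable: it is nontrivial, and in every direct product
representation `A ≅ B × C` one of the two factors is trivial. -/
def DirectlyIndecomposable (L : FirstOrder.Language.{0, 0}) (A : Type u) [L.Structure A] : Prop :=
  Nontrivial A ∧ ∀ (B C : Type u) [L.Structure B] [L.Structure C],
    Nonempty (A ≃[L] B × C) → Subsingleton B ∨ Subsingleton C

/-- The class of directly indecomposable members of the variety defined by `E` is the class of
all (nonempty) models of some set of first-order sentences. -/
def IndecomposablesAxiomatizable {L : FirstOrder.Language.{0, 0}} (E : Identities L) : Prop :=
  ∃ T : L.Theory, ∀ (A : Type u) [L.Structure A] [Nonempty A],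
    A ⊨ T ↔ InVariety E A ∧ DirectlyIndecomposable L A

/-- The value of a closed term in a structure. -/
def closedValue {L : FirstOrder.Language.{0, 0}} (A : Type u) [L.Structure A] (t : L.Term Empty) : A :=
  t.realize Empty.elim

/-- The closed terms `z = (z₁, …, z_l)` and `o = (o₁, …, o_l)` witness that the variety defined
by `E` is a variety with `0⃗ & 1⃗`: in its members, `z⃗ = o⃗` implies `x = y`. -/
def IsZeroOneSystem {L : FirstOrder.Language.{0, 0}} (E : Identities L) {l : ℕ}
    (z o : Fin l → L.Term Empty) : Prop :=
  ∀ (A : Type u) [L.Structure A], InVariety E A →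
    (∀ i, closedValue A (z i) = closedValue A (o i)) → ∀ x y : A, x = y

/-- Definable Factor Congruences of the variety defined by `E`, relative to the closed terms
`z = 0⃗` and `o = 1⃗`: one first-order formula `Φ(x, y, w⃗)` defines, in every product `A × B` of
members, the kernel of the first projection with `w⃗` interpreted by `[0⃗, 1⃗]`. -/
def HasDFC {L : FirstOrder.Language.{0, 0}} (E : Identities L) {l : ℕ} (z o : Fin l → L.Term Empty) : Prop :=
  ∃ Φ : L.Formula (Fin 2 ⊕ Fin l), ∀ (A B : Type u) [L.Structure A] [L.Structure B],
    InVariety E A → InVariety E B → ∀ (a c : A) (b d : B),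
      Φ.Realize (M := A × B) (Sum.elim ![(a, b), (c, d)]
        (fun i => (closedValue A (z i), closedValue B (o i)))) ↔ a = c

/-- The operation symbols `+, *, 0, 1`. -/
inductive LFunc : ℕ → Type
  | zero : LFunc 0
  | one : LFunc 0
  | add : LFunc 2
  | mul : LFunc 2

/-- The algebraic language `{+, *, 0, 1}`. -/
def langL : FirstOrder.Language.{0, 0} := ⟨LFunc, fun _ => Empty⟩

/-- The constant symbol `0`. -/
def fZero : langL.Constants := LFunc.zero

/-- The constant symbol `1`. -/
def fOne : langL.Constants := LFunc.one

/-- The binary symbol `+`. -/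
def fAdd : langL.Functions 2 := LFunc.add

/-- The binary symbol `*`. -/
def fMul : langL.Functions 2 := LFunc.mul

/-- The constant `0` as a term. -/
def tZero {α : Type} : langL.Term α := fZero.term

/-- The constant `1` as a term. -/
def tOne {α : Type} : langL.Term α := fOne.term

/-- The term `s + t`. -/
def tAdd {α : Type} (s t : langL.Term α) : langL.Term α := fAdd.apply₂ s t

/-- The term `s * t`. -/
def tMul {α : Type} (s t : langL.Term α) : langL.Term α := fMul.apply₂ s t

/-- The variable `x`. -/
def tX : langL.Term ℕ := Term.var 0

/-- The identities `x + 0 ≈ x`, `x + 1 ≈ x * 1`, `x * 0 ≈ 0` defining the variety `V_L`. -/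
def VL : Identities langL :=
  {(tAdd tX tZero, tX), (tAdd tX tOne, tMul tX tOne), (tMul tX tZero, tZero)}

end UAlg

/-! In `Pointed P` and in every fibre of `Twisted F`, the operations cannot tell apart the points
other than `0` and `1`. Permuting those points, independently in each fibre, is therefore an
automorphism.

Non-axiomatizability: if every fibre is `ℕ`, the twisted algebra is a product with factor `Two`.
Enlarging only the fibre over `1` to an uncountable set gives an elementary extension
(`mapEmbedding_realize_sentence`), yet the result is indecomposable, since a decomposition would
inject the fibre over `1` into a countable set (`exists_injective_of_equiv`).

Failure of DFC: an automorphism of `Pointed P × Two` exchanging two points over `1` only fixes the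
values of closed terms but does not preserve equality of first coordinates. -/

namespace UAlg

open FirstOrder FirstOrder.Language

/-! ### Algebras in the signature `+, *, 0, 1` -/

section Basic

variable (A : Type u) [langL.Structure A]

/-- The interpretation of `0`. -/
def zeroOf : A := Structure.funMap (L := langL) LFunc.zero ![]

/-- The interpretation of `1`. -/
def oneOf : A := Structure.funMap (L := langL) LFunc.one ![]

variable {A}

/-- The interpretation of `+`. -/
def addOf (x y : A) : A := Structure.funMap (L := langL) LFunc.add ![x, y]

/-- The interpretation of `*`. -/
def mulOf (x y : A) : A := Structure.funMap (L := langL) LFunc.mul ![x, y]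

end Basic

/-- A `langL`-structure from its constants and operations. -/
@[reducible] def structureOf {A : Type u} (z o : A) (add mul : A → A → A) : langL.Structure A where
  funMap {_} f := match f with
    | LFunc.zero => fun _ => z
    | LFunc.one => fun _ => o
    | LFunc.add => fun x => add (x 0) (x 1)
    | LFunc.mul => fun x => mul (x 0) (x 1)
  RelMap r := Empty.elim r

section Terms

variable {A B : Type u} [langL.Structure A] [langL.Structure B]

theorem realize_tZero {α : Type} (v : α → A) : (tZero : langL.Term α).realize v = zeroOf A :=
  congrArg (Structure.funMap (L := langL) LFunc.zero) (Subsingleton.elim _ _)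

theorem realize_tOne {α : Type} (v : α → A) : (tOne : langL.Term α).realize v = oneOf A :=
  congrArg (Structure.funMap (L := langL) LFunc.one) (Subsingleton.elim _ _)

theorem realize_tAdd {α : Type} (s t : langL.Term α) (v : α → A) :
    (tAdd s t).realize v = addOf (s.realize v) (t.realize v) :=
  Term.realize_functions_apply₂

theorem realize_tMul {α : Type} (s t : langL.Term α) (v : α → A) :
    (tMul s t).realize v = mulOf (s.realize v) (t.realize v) :=
  Term.realize_functions_apply₂

theorem inVariety_VL_iff : InVariety VL A ↔ (∀ x : A, addOf x (zeroOf A) = x) ∧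
    (∀ x : A, addOf x (oneOf A) = mulOf x (oneOf A)) ∧ ∀ x : A, mulOf x (zeroOf A) = zeroOf A := by
  constructor
  · rintro ⟨-, h⟩
    refine ⟨fun x => ?_, fun x => ?_, fun x => ?_⟩
    · have := h (tAdd tX tZero, tX) (by simp [VL]) (fun _ => x)
      rwa [realize_tAdd, realize_tZero] at this
    · have := h (tAdd tX tOne, tMul tX tOne) (by simp [VL]) (fun _ => x)
      rwa [realize_tAdd, realize_tMul, realize_tOne] at this
    · have := h (tMul tX tZero, tZero) (by simp [VL]) (fun _ => x)
      rwa [realize_tMul, realize_tZero] at this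
  · rintro ⟨h₁, h₂, h₃⟩
    refine ⟨⟨zeroOf A⟩, ?_⟩
    rintro e (rfl | rfl | rfl) v
    · simpa only [realize_tAdd, realize_tZero] using h₁ _
    · simpa only [realize_tAdd, realize_tMul, realize_tOne] using h₂ _
    · simpa only [realize_tMul, realize_tZero] using h₃ _

/-- In members of `V_L`, `0 = 1` forces triviality. -/
theorem eq_zeroOf_of_zeroOf_eq_oneOf (h : InVariety VL A) (h01 : zeroOf A = oneOf A) (x : A) :
    x = zeroOf A := by
  obtain ⟨h₁, h₂, h₃⟩ := inVariety_VL_iff.1 h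
  -- The chain is `x = x + 0 = x + 1 = x * 1 = x * 0 = 0`.
  have := h₂ x
  rwa [← h01, h₁, h₃] at this

theorem isZeroOneSystem_VL : IsZeroOneSystem.{u} VL ![tZero] ![tOne] := by
  intro A _ h h01 x y
  have h01 := h01 0
  simp only [closedValue, Matrix.cons_val_fin_one, realize_tZero, realize_tOne] at h01
  rw [eq_zeroOf_of_zeroOf_eq_oneOf h h01 x, eq_zeroOf_of_zeroOf_eq_oneOf h h01 y]

theorem eq_vec_two {D : Type u} (x : Fin 2 → D) : x = ![x 0, x 1] :=
  funext (Fin.forall_fin_two.2 ⟨rfl, rfl⟩)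

theorem map_funMap_of (g : A → B) (h0 : g (zeroOf A) = zeroOf B) (h1 : g (oneOf A) = oneOf B)
    (ha : ∀ x y, g (addOf x y) = addOf (g x) (g y))
    (hm : ∀ x y, g (mulOf x y) = mulOf (g x) (g y)) {n : ℕ} (f : langL.Functions n)
    (x : Fin n → A) : g (Structure.funMap f x) = Structure.funMap f (g ∘ x) := by
  cases f with
  | zero => rwa [Subsingleton.elim x ![], Subsingleton.elim (g ∘ ![]) ![] ]
  | one => rwa [Subsingleton.elim x ![], Subsingleton.elim (g ∘ ![]) ![] ]
  | add =>
    rw [eq_vec_two x, eq_vec_two (g ∘ ![x 0, x 1])]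
    exact ha (x 0) (x 1)
  | mul =>
    rw [eq_vec_two x, eq_vec_two (g ∘ ![x 0, x 1])]
    exact hm (x 0) (x 1)

/-- A map preserving the constants and operations is a homomorphism. -/
def homOf (g : A → B) (h0 : g (zeroOf A) = zeroOf B) (h1 : g (oneOf A) = oneOf B)
    (ha : ∀ x y, g (addOf x y) = addOf (g x) (g y))
    (hm : ∀ x y, g (mulOf x y) = mulOf (g x) (g y)) : A →[langL] B where
  toFun := g
  map_fun' f x := map_funMap_of g h0 h1 ha hm f x
  map_rel' r := Empty.elim r

/-- An injection preserving the constants and operations is an embedding. -/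
def embeddingOf (g : A ↪ B) (h0 : g (zeroOf A) = zeroOf B) (h1 : g (oneOf A) = oneOf B)
    (ha : ∀ x y, g (addOf x y) = addOf (g x) (g y))
    (hm : ∀ x y, g (mulOf x y) = mulOf (g x) (g y)) : A ↪[langL] B where
  toEmbedding := g
  map_fun' f x := map_funMap_of g h0 h1 ha hm f x
  map_rel' r := Empty.elim r

/-- A bijection preserving the constants and operations is an isomorphism. -/
def equivOf (g : A ≃ B) (h0 : g (zeroOf A) = zeroOf B) (h1 : g (oneOf A) = oneOf B)
    (ha : ∀ x y, g (addOf x y) = addOf (g x) (g y))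
    (hm : ∀ x y, g (mulOf x y) = mulOf (g x) (g y)) : A ≃[langL] B where
  toEquiv := g
  map_fun' f x := map_funMap_of g h0 h1 ha hm f x
  map_rel' r := Empty.elim r

theorem map_zeroOf (g : A ≃[langL] B) : g (zeroOf A) = zeroOf B :=
  (g.map_fun _ _).trans (congrArg _ (Subsingleton.elim _ _))

theorem map_oneOf (g : A ≃[langL] B) : g (oneOf A) = oneOf B :=
  (g.map_fun _ _).trans (congrArg _ (Subsingleton.elim _ _))

theorem map_addOf (g : A ≃[langL] B) (x y : A) : g (addOf x y) = addOf (g x) (g y) := by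
  refine (g.map_fun _ _).trans (congrArg _ ?_)
  ext i; fin_cases i <;> rfl

theorem map_mulOf (g : A ≃[langL] B) (x y : A) : g (mulOf x y) = mulOf (g x) (g y) := by
  refine (g.map_fun _ _).trans (congrArg _ ?_)
  ext i; fin_cases i <;> rfl

theorem InVariety.of_equiv (g : A ≃[langL] B) (h : InVariety VL A) : InVariety VL B := by
  obtain ⟨h₁, h₂, h₃⟩ := inVariety_VL_iff.1 h
  refine inVariety_VL_iff.2 ⟨fun x => ?_, fun x => ?_, fun x => ?_⟩ <;>
    obtain ⟨x, rfl⟩ := g.surjective x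
  · rw [← map_zeroOf g, ← map_addOf, h₁]
  · rw [← map_oneOf g, ← map_addOf, ← map_mulOf, h₂]
  · rw [← map_zeroOf g, ← map_mulOf, h₃]

theorem zeroOf_prod : zeroOf (A × B) = (zeroOf A, zeroOf B) :=
  Prod.ext (congrArg (Structure.funMap (L := langL) LFunc.zero) (Subsingleton.elim _ _))
    (congrArg (Structure.funMap (L := langL) LFunc.zero) (Subsingleton.elim _ _))

theorem oneOf_prod : oneOf (A × B) = (oneOf A, oneOf B) :=
  Prod.ext (congrArg (Structure.funMap (L := langL) LFunc.one) (Subsingleton.elim _ _))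
    (congrArg (Structure.funMap (L := langL) LFunc.one) (Subsingleton.elim _ _))

theorem addOf_prod (x y : A × B) : addOf x y = (addOf x.1 y.1, addOf x.2 y.2) := by
  refine Prod.ext (congrArg (Structure.funMap (L := langL) LFunc.add) ?_)
    (congrArg (Structure.funMap (L := langL) LFunc.add) ?_) <;> (ext i; fin_cases i <;> rfl)

theorem mulOf_prod (x y : A × B) : mulOf x y = (mulOf x.1 y.1, mulOf x.2 y.2) := by
  refine Prod.ext (congrArg (Structure.funMap (L := langL) LFunc.mul) ?_)
    (congrArg (Structure.funMap (L := langL) LFunc.mul) ?_) <;> (ext i; fin_cases i <;> rfl)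

/-- Direct products of algebras commute. -/
def prodCommEquiv (A B : Type u) [langL.Structure A] [langL.Structure B] :
    (A × B) ≃[langL] (B × A) :=
  equivOf (Equiv.prodComm A B) (by simp [zeroOf_prod]) (by simp [oneOf_prod])
    (by simp [addOf_prod]) (by simp [mulOf_prod])

theorem InVariety.fst_of_prod (h : InVariety VL (A × B)) : InVariety VL A := by
  obtain ⟨h₁, h₂, h₃⟩ := inVariety_VL_iff.1 h
  refine inVariety_VL_iff.2 ⟨fun x => ?_, fun x => ?_, fun x => ?_⟩
  · simpa [addOf_prod, zeroOf_prod] using congrArg Prod.fst (h₁ (x, zeroOf B))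
  · simpa [addOf_prod, mulOf_prod, oneOf_prod] using congrArg Prod.fst (h₂ (x, zeroOf B))
  · simpa [mulOf_prod, zeroOf_prod] using congrArg Prod.fst (h₃ (x, zeroOf B))

end Terms

/-! ### Pointed sets as members of the variety -/

/-- The set `P` with two further points `0` and `1`. -/
inductive Pointed (P : Type u) : Type u
  | zero : Pointed P
  | one : Pointed P
  | pt (p : P) : Pointed P

namespace Pointed

variable {P Q R : Type u}

/-- The map sending `0` to `0` and everything else to `1`. -/
def retract : Pointed P → Pointed R
  | zero => zero
  | _ => one

/-- `x + y` is `x` if `y = 0`, and the retraction of `x` to `{0, 1}` otherwise. -/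
def add (x : Pointed P) : Pointed Q → Pointed P
  | zero => x
  | _ => retract x

/-- `x * y` is the meet of the retractions of `x` and `y` to `{0, 1}`. -/
def mul (x : Pointed P) : Pointed Q → Pointed R
  | zero => zero
  | _ => retract x

instance : langL.Structure (Pointed P) := structureOf zero one add mul

/-- The action of a map on the points other than `0` and `1`. -/
def map (g : P → Q) : Pointed P → Pointed Q
  | zero => zero
  | one => one
  | pt p => pt (g p)

theorem map_injective {g : P → Q} (hg : g.Injective) : (map g).Injective := by
  rintro (_ | _ | p) (_ | _ | q) h <;> simp_all [map, hg.eq_iff]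

theorem map_surjective {g : P → Q} (hg : g.Surjective) : (map g).Surjective := by
  rintro (_ | _ | q)
  · exact ⟨zero, rfl⟩
  · exact ⟨one, rfl⟩
  · obtain ⟨p, rfl⟩ := hg q
    exact ⟨pt p, rfl⟩

theorem map_add {P' Q' : Type u} (g : P → P') (k : Q → Q') (x : Pointed P) (y : Pointed Q) :
    map g (add x y) = add (map g x) (map k y) := by
  cases x <;> cases y <;> rfl

/-- Products are always `0` or `1`, so factors and result may live over unrelated point sets; this
is what multiplication across fibres requires. -/
theorem map_mul {P' Q' R' : Type u} (g : P → P') (k : Q → Q') (m : R → R') (x : Pointed P)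
    (y : Pointed Q) : map m (mul x y : Pointed R) = mul (map g x) (map k y) := by
  cases x <;> cases y <;> rfl

/-- The homomorphism induced by a map of the points other than `0` and `1`. -/
def mapHom (g : P → Q) : Pointed P →[langL] Pointed Q :=
  homOf (map g) rfl rfl (map_add g g) (map_mul g g g)

theorem inVariety : InVariety VL (Pointed P) :=
  inVariety_VL_iff.2 ⟨fun _ => rfl, fun _ => rfl, fun _ => rfl⟩

instance countable [Countable P] : Countable (Pointed P) := by
  let g : Pointed P → Option (Option P)
    | zero => none
    | one => some none
    | pt p => some (some p)
  refine Function.Injective.countable (f := g) ?_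
  rintro (_ | _ | p) (_ | _ | q) h <;> simp_all [g]

end Pointed

/-! ### Twisted products over the two-element algebra -/

/-- The two-element algebra `{0, 1}`. -/
abbrev Two : Type u := Pointed PEmpty.{u + 1}

/-- Pairs of a second coordinate `t` in `{0, 1}` and a first coordinate in a set `Pointed (F t)`
that depends on `t`. -/
structure Twisted (F : Two.{u} → Type u) : Type u where
  /-- The second coordinate. -/
  idx : Two.{u}
  /-- The first coordinate. -/
  val : Pointed (F idx)

namespace Twisted

variable {F G : Two.{u} → Type u}

/-- In `Two` one has `s + t = s`, so keeping the left index is coordinatewise addition, and the sum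
stays in the fibre of its left summand. -/
instance : langL.Structure (Twisted F) :=
  structureOf ⟨.zero, .zero⟩ ⟨.one, .one⟩ (fun x y => ⟨x.1, x.2.add y.2⟩)
    (fun x y => ⟨x.1.mul y.1, x.2.mul y.2⟩)

theorem inVariety : InVariety VL (Twisted F) := by
  refine inVariety_VL_iff.2 ⟨fun _ => rfl, ?_, fun _ => rfl⟩
  rintro ⟨_ | _ | ⟨⟨⟩⟩, a⟩ <;> rfl

/-- The map of twisted algebras induced by maps of fibres. -/
def map (j : ∀ t, F t → G t) (x : Twisted F) : Twisted G := ⟨x.1, x.2.map (j x.1)⟩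

theorem map_injective {j : ∀ t, F t → G t} (hj : ∀ t, (j t).Injective) : (map j).Injective := by
  rintro ⟨t, x⟩ ⟨s, y⟩ h
  obtain rfl : t = s := congrArg Twisted.idx h
  exact congrArg (Twisted.mk t) (Pointed.map_injective (hj t) (eq_of_heq (Twisted.mk.inj h).2))

theorem map_surjective {j : ∀ t, F t → G t} (hj : ∀ t, (j t).Surjective) :
    (map j).Surjective := by
  rintro ⟨t, y⟩
  obtain ⟨x, rfl⟩ := Pointed.map_surjective (hj t) y
  exact ⟨⟨t, x⟩, rfl⟩

theorem map_addOf (j : ∀ t, F t → G t) (x y : Twisted F) :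
    map j (addOf x y) = addOf (map j x) (map j y) :=
  congrArg (Twisted.mk x.1) (Pointed.map_add _ (j y.1) _ _)

theorem map_mulOf (j : ∀ t, F t → G t) (x y : Twisted F) :
    map j (mulOf x y) = mulOf (map j x) (map j y) :=
  congrArg (Twisted.mk (x.1.mul y.1)) (Pointed.map_mul _ (j y.1) _ _ _)

/-- The embedding of twisted algebras induced by injections of fibres. -/
def mapEmbedding (j : ∀ t, F t → G t) (hj : ∀ t, (j t).Injective) :
    Twisted F ↪[langL] Twisted G :=
  embeddingOf ⟨map j, map_injective hj⟩ rfl rfl (map_addOf j) (map_mulOf j)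

/-- The automorphism of a twisted algebra induced by permutations of the fibres. -/
noncomputable def permEquiv (σ : ∀ t, Equiv.Perm (F t)) : Twisted F ≃[langL] Twisted F :=
  equivOf (Equiv.ofBijective (map fun t => σ t)
    ⟨map_injective fun t => (σ t).injective, map_surjective fun t => (σ t).surjective⟩)
    rfl rfl (map_addOf fun t => σ t) (map_mulOf fun t => σ t)

/-- A twisted algebra with constant fibre is a direct product. -/
def prodEquiv (P : Type u) : Twisted (fun _ => P) ≃[langL] Pointed P × Two.{u} :=
  equivOf
    { toFun := fun x => (x.2, x.1)
      invFun := fun x => ⟨x.2, x.1⟩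
      left_inv := fun _ => rfl
      right_inv := fun _ => rfl } zeroOf_prod.symm oneOf_prod.symm
    (by
      rintro ⟨t, x⟩ ⟨s, y⟩
      refine Eq.trans ?_ (addOf_prod (A := Pointed P) (B := Two.{u}) (x, t) (y, s)).symm
      rcases t with _ | _ | ⟨⟨⟩⟩ <;> rcases s with _ | _ | ⟨⟨⟩⟩ <;> rfl)
    (fun x y => (mulOf_prod (A := Pointed P) (B := Two.{u}) (x.2, x.1) (y.2, y.1)).symm)

/-! ### Elementary embeddings by swapping points -/

open Classical in
/-- Injections with infinite domains between the fibres induce elementary embeddings. -/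
theorem mapEmbedding_realize_sentence [∀ t, Infinite (F t)] (j : ∀ t, F t → G t)
    (hj : ∀ t, (j t).Injective) (φ : langL.Sentence) :
    Twisted F ⊨ φ ↔ Twisted G ⊨ φ := by
  -- What remains is the Tarski–Vaught test: a witness `a` has to be moved into the range.
  refine ((mapEmbedding j hj).toElementaryEmbedding ?_).map_sentence φ
  intro n ψ x a ha
  by_cases hr : a ∈ Set.range (mapEmbedding j hj)
  · obtain ⟨b, rfl⟩ := hr
    exact ⟨b, ha⟩
  obtain ⟨t, _ | _ | g⟩ := a
  · exact (hr ⟨⟨t, .zero⟩, rfl⟩).elim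
  · exact (hr ⟨⟨t, .one⟩, rfl⟩).elim
  have hinj : Function.Injective fun m : F t => (⟨t, .pt m⟩ : Twisted F) := by
    intro m m' h
    simpa using eq_of_heq (Twisted.mk.inj h).2
  obtain ⟨m, hm⟩ : ∃ m : F t, (⟨t, .pt m⟩ : Twisted F) ∉ Set.range x := by
    by_contra! h
    exact Set.infinite_of_injective_forall_mem hinj h (Set.finite_range x)
  refine ⟨⟨t, .pt m⟩, ?_⟩
  -- This swap fixes every parameter, because `g` is outside the range of `j t` and `m` avoids the
  -- tuple `x`.
  let σ : ∀ s, Equiv.Perm (G s) := Function.update (fun _ => 1) t (Equiv.swap g (j t m))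
  have hσt : σ t = Equiv.swap g (j t m) := Function.update_self ..
  have hσ : ∀ s, s ≠ t → σ s = 1 := fun s hs => Function.update_of_ne hs ..
  have hfix : ∀ i, permEquiv σ (mapEmbedding j hj (x i)) = mapEmbedding j hj (x i) := by
    intro i
    have hi : x i ≠ ⟨t, .pt m⟩ := fun h => hm ⟨i, h⟩
    generalize x i = y at hi
    obtain ⟨s, y⟩ := y
    refine congrArg (fun y => (⟨s, y⟩ : Twisted G)) ?_
    cases y with
    | zero => rfl
    | one => rfl
    | pt q =>
      refine congrArg Pointed.pt ?_
      change σ s (j s q) = j s q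
      by_cases hs : s = t
      · subst hs
        rw [hσt]
        refine Equiv.swap_apply_of_ne_of_ne ?_ ?_
        · rintro rfl
          exact hr ⟨⟨s, .pt q⟩, rfl⟩
        · intro h
          exact hi (by rw [hj s h])
      · rw [hσ s hs]; rfl
  have hg : permEquiv σ (⟨t, .pt g⟩ : Twisted G) = mapEmbedding j hj ⟨t, .pt m⟩ := by
    refine congrArg (fun p => (⟨t, .pt p⟩ : Twisted G)) ?_
    change σ t g = j t m
    rw [hσt, Equiv.swap_apply_left]
  have := (StrongHomClass.realize_boundedFormula (permEquiv σ) ψ).2 ha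
  convert this using 1
  · rw [Fin.comp_snoc, hg]
    congr 1
    funext i
    exact (hfix i).symm

/-! ### Direct indecomposability -/

/-- In a decomposition `B × C` the elements `(0, 1)` and `(1, 0)` must come from this list, which
pins them down up to order. -/
theorem eq_of_mulOf_oneOf_eq_self {x : Twisted F} (h : mulOf x (oneOf _) = x) :
    x = zeroOf _ ∨ x = oneOf _ ∨ x = ⟨.one, .zero⟩ ∨ x = ⟨.zero, .one⟩ := by
  obtain ⟨_ | _ | ⟨⟨⟩⟩, _ | _ | p⟩ := x
  · exact .inl rfl
  · exact .inr (.inr (.inr rfl))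
  · cases h
  · exact .inr (.inr (.inl rfl))
  · exact .inr (.inl rfl)
  · cases h

theorem exists_eq_of_mulOf_eq_zeroOf {x : Twisted F} (h : mulOf x ⟨.one, .zero⟩ = zeroOf _) :
    ∃ p, x = ⟨.zero, p⟩ := by
  obtain ⟨_ | _ | ⟨⟨⟩⟩, x⟩ := x
  · exact ⟨x, rfl⟩
  · cases h

/-- Multiplying by `1` keeps the index and retracts the value, and only `0` retracts to `0`. -/
theorem eq_of_mulOf_oneOf_eq {x : Twisted F}
    (h : mulOf x (oneOf _) = (⟨.one, .zero⟩ : Twisted F)) : x = ⟨.one, .zero⟩ := by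
  obtain ⟨_ | _ | ⟨⟨⟩⟩, _ | _ | p⟩ := x <;> first | rfl | cases h

/-- A decomposition in which `(0, 1)` is the obvious element makes the fibre over `1` embed into
the part over `0`. -/
theorem exists_injective_of_equiv {B C : Type u} [langL.Structure B] [langL.Structure C]
    (φ : Twisted F ≃[langL] B × C)
    (hφ : φ ⟨.one, .zero⟩ = (zeroOf B, oneOf C)) :
    ∃ k : F .one → Pointed (F .zero), k.Injective := by
  have hBC : InVariety VL (B × C) := inVariety.of_equiv φ
  have hB := (inVariety_VL_iff.1 hBC.fst_of_prod).2.2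
  -- `0 * 1 = 0` is not among the identities of `V_L`; the factors inherit it from `Twisted F`.
  have h01 : mulOf (zeroOf B) (oneOf B) = zeroOf B ∧ mulOf (zeroOf C) (oneOf C) = zeroOf C := by
    have := UAlg.map_mulOf φ (zeroOf _) (oneOf _)
    rw [show mulOf (zeroOf _) (oneOf _) = zeroOf (Twisted F) from rfl, map_zeroOf, map_oneOf,
      zeroOf_prod, oneOf_prod, mulOf_prod] at this
    exact ⟨(congrArg Prod.fst this).symm, (congrArg Prod.snd this).symm⟩
  -- All points over `1` share the second coordinate `1`, so the first one determines `q`.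
  have key : ∀ q : F .one, (φ ⟨.one, .pt q⟩).2 = oneOf C := by
    intro q
    have h := UAlg.map_mulOf φ ⟨.one, .pt q⟩ (oneOf _)
    rw [show mulOf ⟨.one, .pt q⟩ (oneOf _) = oneOf (Twisted F) from rfl, map_oneOf, oneOf_prod,
      mulOf_prod] at h
    have hx : mulOf (φ.symm (zeroOf B, (φ ⟨.one, .pt q⟩).2)) (oneOf _) =
        (⟨.one, .zero⟩ : Twisted F) := by
      apply φ.injective
      rw [UAlg.map_mulOf, hφ, φ.apply_symm_apply, map_oneOf, oneOf_prod, mulOf_prod]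
      exact Prod.ext h01.1 (congrArg Prod.snd h).symm
    have := eq_of_mulOf_oneOf_eq hx
    rw [← this, φ.apply_symm_apply] at hφ
    exact congrArg Prod.snd hφ
  -- Since `(b, 0) * (0, 1) = (0, 0)`, the copy of `B` over `0` lies in the fibre over `0`.
  have hzero : ∀ b : B, ∃ p, φ.symm (b, zeroOf C) = ⟨.zero, p⟩ := by
    intro b
    apply exists_eq_of_mulOf_eq_zeroOf
    apply φ.injective
    rw [UAlg.map_mulOf, hφ, φ.apply_symm_apply, map_zeroOf, zeroOf_prod, mulOf_prod]
    exact Prod.ext (hB b) h01.2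
  choose p hp using hzero
  refine ⟨fun q => p (φ ⟨.one, .pt q⟩).1, fun q q' h => ?_⟩
  have h₁ := (hp _).trans ((congrArg (Twisted.mk .zero) h).trans (hp _).symm)
  have h₂ := congrArg Prod.fst (φ.symm.injective h₁)
  have := φ.injective (Prod.ext h₂ ((key q).trans (key q').symm))
  simpa using this

theorem directlyIndecomposable [Countable (F .zero)] [Uncountable (F .one)] :
    DirectlyIndecomposable langL (Twisted F) := by
  refine ⟨⟨⟨.zero, .zero⟩, ⟨.one, .one⟩, fun h => by cases congrArg Twisted.idx h⟩, ?_⟩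
  rintro B C _ _ ⟨φ⟩
  by_contra! hBC
  obtain ⟨hnB, hnC⟩ := hBC
  have hV : InVariety VL (B × C) := inVariety.of_equiv φ
  have hB : zeroOf B ≠ oneOf B := fun h => not_subsingleton B
    ⟨fun x y => (eq_zeroOf_of_zeroOf_eq_oneOf hV.fst_of_prod h x).trans
      (eq_zeroOf_of_zeroOf_eq_oneOf hV.fst_of_prod h y).symm⟩
  have hV' := hV.of_equiv (prodCommEquiv B C)
  have hC : zeroOf C ≠ oneOf C := fun h => not_subsingleton C
    ⟨fun x y => (eq_zeroOf_of_zeroOf_eq_oneOf hV'.fst_of_prod h x).trans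
      (eq_zeroOf_of_zeroOf_eq_oneOf hV'.fst_of_prod h y).symm⟩
  have h00 := UAlg.map_mulOf φ (zeroOf _) (oneOf _)
  have h11 := UAlg.map_mulOf φ (oneOf _) (oneOf _)
  rw [show mulOf (zeroOf _) (oneOf _) = zeroOf (Twisted F) from rfl, map_zeroOf, map_oneOf,
    zeroOf_prod, oneOf_prod, mulOf_prod, Prod.ext_iff] at h00
  rw [show mulOf (oneOf _) (oneOf _) = oneOf (Twisted F) from rfl, map_oneOf,
    oneOf_prod, mulOf_prod, Prod.ext_iff] at h11
  have hno : ¬ ∃ k : F .one → Pointed (F .zero), k.Injective := fun ⟨k, hk⟩ =>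
    not_countable (α := F .one) hk.countable
  have cases_of : ∀ y : B × C, mulOf y (oneOf _) = y → y ≠ zeroOf _ → y ≠ oneOf _ →
      φ ⟨.one, .zero⟩ = y ∨ φ ⟨.zero, .one⟩ = y := by
    intro y hy hy0 hy1
    obtain ⟨x, rfl⟩ := φ.surjective y
    rw [← map_oneOf φ, ← UAlg.map_mulOf] at hy
    rcases eq_of_mulOf_oneOf_eq_self (φ.injective hy) with rfl | rfl | rfl | rfl
    · exact (hy0 (map_zeroOf φ)).elim
    · exact (hy1 (map_oneOf φ)).elim
    · exact .inl rfl
    · exact .inr rfl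
  have c₁ := cases_of (zeroOf B, oneOf C)
    (by rw [oneOf_prod, mulOf_prod]; exact Prod.ext h00.1.symm h11.2.symm)
    (by rw [zeroOf_prod]; exact fun h => hC (congrArg Prod.snd h).symm)
    (by rw [oneOf_prod]; exact fun h => hB (congrArg Prod.fst h))
  have c₂ := cases_of (oneOf B, zeroOf C)
    (by rw [oneOf_prod, mulOf_prod]; exact Prod.ext h11.1.symm h00.2.symm)
    (by rw [zeroOf_prod]; exact fun h => hB (congrArg Prod.fst h).symm)
    (by rw [oneOf_prod]; exact fun h => hC (congrArg Prod.snd h))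
  -- Up to exchanging the factors, `⟨1, 0⟩` corresponds to `(0, 1)`; otherwise `⟨0, 1⟩` would have
  -- two images.
  rcases c₁ with c₁ | c₁
  · exact hno (exists_injective_of_equiv φ c₁)
  rcases c₂ with c₂ | c₂
  · refine hno (exists_injective_of_equiv ((prodCommEquiv B C).comp φ) ?_)
    change (prodCommEquiv B C) (φ _) = _
    rw [c₂]
    rfl
  · exact hB (congrArg Prod.fst (c₁.symm.trans c₂))

end Twisted

/-! ### Non-axiomatizability -/

/-- Fibres of which only the one over `1` is uncountable. -/
def unbalancedFibre : Two.{u} → Type u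
  | .one => ULift (Set ℕ)
  | _ => ULift ℕ

/-- Injections of a countable fibre into the fibres `unbalancedFibre t`. -/
def toUnbalancedFibre : ∀ t : Two.{u}, ULift.{u} ℕ → unbalancedFibre t
  | .one => fun n => ULift.up {n.down}
  | .zero => id
  | .pt _ => id

theorem toUnbalancedFibre_injective (t : Two.{u}) : (toUnbalancedFibre t).Injective := by
  rcases t with _ | _ | ⟨⟨⟩⟩
  · exact Function.injective_id
  · intro m n h
    exact ULift.ext _ _ (Set.singleton_injective (ULift.up_injective h))

theorem not_indecomposablesAxiomatizable_VL : ¬ IndecomposablesAxiomatizable.{u} VL := by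
  rintro ⟨T, hT⟩
  have : Countable (unbalancedFibre.{u} .zero) := inferInstanceAs (Countable (ULift ℕ))
  have : Uncountable (unbalancedFibre.{u} .one) := by
    refine ⟨fun h => ?_⟩
    have : Countable (Set ℕ) := (Equiv.ulift (α := Set ℕ)).countable_iff.1 h
    obtain ⟨f, hf⟩ := exists_injective_nat (Set ℕ)
    exact Function.cantor_injective f hf
  have : Nonempty (Twisted unbalancedFibre.{u}) := Twisted.inVariety.1
  have : Nonempty (Twisted fun _ : Two.{u} => ULift.{u} ℕ) := Twisted.inVariety.1
  have h₁ : Twisted unbalancedFibre.{u} ⊨ T :=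
    (hT _).2 ⟨Twisted.inVariety, Twisted.directlyIndecomposable⟩
  have h₂ : Twisted (fun _ : Two.{u} => ULift.{u} ℕ) ⊨ T :=
    ⟨fun φ hφ => (Twisted.mapEmbedding_realize_sentence toUnbalancedFibre
      toUnbalancedFibre_injective φ).2 (h₁.realize_of_mem φ hφ)⟩
  rcases ((hT _).1 h₂).2.2 _ _ ⟨Twisted.prodEquiv _⟩ with h | h
  · cases h.elim (Pointed.zero : Pointed (ULift.{u} ℕ)) .one
  · cases h.elim (Pointed.zero : Two.{u}) .one

/-! ### Failure of Definable Factor Congruences -/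

/-- The permutations of the fibres of a constant twisted algebra that exchange two points in the
fibre over `1` only. -/
def swapOverOne : ∀ _ : Two.{u}, Equiv.Perm (ULift.{u} Bool)
  | .one => Equiv.swap ⟨true⟩ ⟨false⟩
  | _ => 1

theorem not_hasDFC_VL {l : ℕ} (z o : Fin l → langL.Term Empty) : ¬ HasDFC.{u} VL z o := by
  rintro ⟨Φ, hΦ⟩
  let P := ULift.{u} Bool
  let σ : (Pointed P × Two.{u}) ≃[langL] (Pointed P × Two.{u}) :=
    ((Twisted.prodEquiv P).comp (Twisted.permEquiv swapOverOne)).comp (Twisted.prodEquiv P).symm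
  have hconst : ∀ (s t : Two.{u}), σ (s.map PEmpty.elim, t) = (s.map PEmpty.elim, t) := by
    rintro (_ | _ | ⟨⟨⟩⟩) t <;> rfl
  -- Closed terms take values in the subalgebra `{0, 1}`, the image of `Two`, so `σ` fixes the
  -- parameters whatever terms are chosen.
  have hclosed : ∀ t : langL.Term Empty,
      closedValue (Pointed P) t = (closedValue Two.{u} t).map PEmpty.elim := by
    intro t
    refine Eq.trans ?_ (HomClass.realize_term (Pointed.mapHom PEmpty.elim))
    exact congrArg (fun v => t.realize v) (Subsingleton.elim _ _)
  let a : Pointed P := .pt ⟨true⟩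
  let a' : Pointed P := .pt ⟨false⟩
  have h₁ := (hΦ (Pointed P) Two.{u} Pointed.inVariety Pointed.inVariety a a .zero .one).2 rfl
  have h₂ := (hΦ (Pointed P) Two.{u} Pointed.inVariety Pointed.inVariety a a' .zero .one).1
  -- `σ` fixes `(a, 0)` and sends `(a, 1)` to `(a', 1)`.
  rw [← StrongHomClass.realize_formula σ] at h₁
  have ha : a = a' := by
    apply h₂
    convert h₁ using 1
    funext i
    rcases i with i | i
    · fin_cases i
      · rfl
      · refine Prod.ext (congrArg Pointed.pt ?_) rfl
        exact (Equiv.swap_apply_left _ _).symm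
    · simp only [Sum.elim_inr, Function.comp_apply, hclosed, hconst]
  exact Bool.noConfusion (congrArg ULift.down (Pointed.pt.inj ha))

end UAlg

/-- In the variety `V_L`, the directly indecomposable members are not first-order axiomatizable;
`V_L` is a variety with `0⃗ & 1⃗`, witnessed by the constants `0` and `1`; and it does not have
Definable Factor Congruences, whichever closed terms `0⃗`, `1⃗` are chosen. -/
theorem mainTheorem8 :
    ¬ UAlg.IndecomposablesAxiomatizable.{u} UAlg.VL ∧
    UAlg.IsZeroOneSystem.{u} UAlg.VL ![UAlg.tZero] ![UAlg.tOne] ∧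
    ∀ (l : ℕ) (z o : Fin l → UAlg.langL.Term Empty),
      UAlg.IsZeroOneSystem.{u} UAlg.VL z o → ¬ UAlg.HasDFC.{u} UAlg.VL z o :=
  ⟨UAlg.not_indecomposablesAxiomatizable_VL, UAlg.isZeroOneSystem_VL,
    fun _ z o _ => UAlg.not_hasDFC_VL z o⟩
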